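/- Let $E_{ij}$ ($1\le i,j\le 3$) be the matrix units of $M_3(\mathbb{C})$ and let $$w^-=\sum_{i,j=1}^{3}\varepsilon_{ij}\,E_{ij}\otimes E_{ji},\qquad \varepsilon_{ij}=\begin{cases}1,& i=j,\\ -1,& i\neq j.\end{cases}$$ For $x\in M_3(\mathbb{C})\otimes M_3(\mathbb{C})$ let $$\pi(x)=\inf\Big\{\sum_{i=1}^k\|a_i\|\,\|b_i\|_1 \;:\; k\in\mathbb{N},\ x=\sum_{i=1}^k a_i\otimes b_i,\ a_i,b_i\in M_3(\mathbb{C})\Big\}$$ be the projective norm, where $\|\cdot\|$ is the operator norm and $\|b\|_1=\operatorname{Tr}\,(b^*b)^{1/2}$ is the trace norm, and let $$\alpha(\rho)=\sup\Big\{\frac{|\operatorname{Tr}\rho a|}{\pi(a)} \;:\; a\in M_3(\mathbb{C})\otimes M_3(\mathbb{C}),\ a\neq 0\Big\}$$ be its dual norm. An operator $\rho$ on $\mathbb{C}^3\otimes\mathbb{C}^3$ is called block positive if $(x\otimes y,\rho\,(x\otimes y))\ge 0$ for all $x,y\in\mathbb{C}^3$. Then $w^-$ is a symmetry (a self-adjoint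 unitary) on $\mathbb{C}^3\otimes\mathbb{C}^3$, it is not block positive, and $\alpha(w^-)=5/3$. -/

import Mathlib

open scoped Kronecker

noncomputable section

section

variable {n : Type*} [Fintype n] [DecidableEq n]

/-- The operator norm of a complex square matrix acting on the Hilbert space `ℂⁿ`. -/
def opNorm (a : Matrix n n ℂ) : ℝ := ‖Matrix.toEuclideanCLM (n := n) (𝕜 := ℂ) a‖

open scoped MatrixOrder in
/-- The trace norm `‖b‖₁ = Tr |b|`, where `|b| = (b* b)^{1/2}` is `CFC.abs b`. -/
def traceNorm (b : Matrix n n ℂ) : ℝ := (CFC.abs b).trace.re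

/-- The projective norm on `M_n ⊗ M_n`, where the first factor carries the operator norm and the
second one the trace norm. The tensor product `M_n ⊗ M_n` is realized, through the Kronecker
product, as the space of matrices indexed by `n × n`. -/
def projNorm (x : Matrix (n × n) (n × n) ℂ) : ℝ :=
  sInf {r : ℝ | ∃ (k : ℕ) (a b : Fin k → Matrix n n ℂ),
    x = ∑ i, a i ⊗ₖ b i ∧ r = ∑ i, opNorm (a i) * traceNorm (b i)}

/-- The norm `α` dual to the projective norm under the trace pairing. -/
def alphaNorm (ρ : Matrix (n × n) (n × n) ℂ) : ℝ :=
  sSup {r : ℝ | ∃ a : Matrix (n × n) (n × n) ℂ, a ≠ 0 ∧ r = ‖(ρ * a).trace‖ / projNorm a}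

/-- A symmetry is a self-adjoint unitary. -/
def IsSymmetry (s : Matrix n n ℂ) : Prop :=
  IsSelfAdjoint s ∧ s ∈ Matrix.unitaryGroup n ℂ

/-- The elementary tensor `x ⊗ y` in `ℂⁿ ⊗ ℂⁿ`. -/
def tensorVec (x y : n → ℂ) : n × n → ℂ := fun p => x p.1 * y p.2

open scoped ComplexOrder in
/-- Block positivity: `(x ⊗ y, ρ (x ⊗ y)) ≥ 0` (a non-negative real number) for all `x`, `y`. -/
def IsBlockPositive (ρ : Matrix (n × n) (n × n) ℂ) : Prop :=
  ∀ x y : n → ℂ, 0 ≤ star (tensorVec x y) ⬝ᵥ (ρ.mulVec (tensorVec x y))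

end

/-- The signed swap `w⁻ = ∑ ε_ij E_ij ⊗ E_ji` on `ℂ³ ⊗ ℂ³`, with `ε_ij = 1` if `i = j` and
`ε_ij = -1` if `i ≠ j`. -/
def wMinus : Matrix (Fin 3 × Fin 3) (Fin 3 × Fin 3) ℂ :=
  ∑ i : Fin 3, ∑ j : Fin 3, (if i = j then (1 : ℂ) else -1) •
    (Matrix.single i j (1 : ℂ) ⊗ₖ Matrix.single j i (1 : ℂ))

end

/-!
The trace pairing of the signed swap with `a ⊗ b` is `Tr (Λ(a) b)`, where `Λ` changes the sign of
the off-diagonal entries. By trace duality `α` is therefore the norm of the Schur multiplier `Λ` on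
`M_N` with the operator norm. Pinching onto the diagonal is the average of the `N` unitary
conjugations by the characters of a cyclic group of order `N`, one of which is the identity, so
`Λ = 2 diag - id` has norm at most `(1 - 2 / N) + 2 (N - 1) / N = 3 - 4 / N`. For the projection `P`
onto the constant vectors, the reflection `2 P - 1`, paired with `P`, attains this bound.
-/

section TraceDuality

variable {n : Type*} [Fintype n] [DecidableEq n]

open scoped Matrix.Norms.L2Operator in
lemma opNorm_eq_norm (a : Matrix n n ℂ) : opNorm a = ‖a‖ := rfl

lemma opNorm_nonneg (a : Matrix n n ℂ) : 0 ≤ opNorm a := norm_nonneg _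

open scoped MatrixOrder ComplexOrder in
lemma traceNorm_nonneg (b : Matrix n n ℂ) : 0 ≤ traceNorm b :=
  (Complex.le_def.1 (Matrix.nonneg_iff_posSemidef.1 (CFC.abs_nonneg b)).trace_nonneg).1

lemma trace_eq_sum_inner_toEuclideanCLM {ι : Type*} [Fintype ι] (c : Matrix n n ℂ)
    (v : OrthonormalBasis ι ℂ (EuclideanSpace ℂ n)) :
    c.trace = ∑ i, inner ℂ (v i) (Matrix.toEuclideanCLM (n := n) (𝕜 := ℂ) c (v i)) := by
  have htrace : LinearMap.trace ℂ _ (Matrix.toEuclideanLin c) = c.trace := by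
    rw [Matrix.toEuclideanLin_eq_toLin_orthonormal, Matrix.trace_toLin_eq]
  rw [← htrace, LinearMap.trace_eq_sum_inner _ v]
  simp only [← Matrix.coe_toEuclideanCLM_eq_toEuclideanLin, ContinuousLinearMap.coe_coe]

open scoped MatrixOrder in
lemma norm_toEuclideanCLM_abs_apply (b : Matrix n n ℂ) (x : EuclideanSpace ℂ n) :
    ‖Matrix.toEuclideanCLM (n := n) (𝕜 := ℂ) (CFC.abs b) x‖ =
      ‖Matrix.toEuclideanCLM (n := n) (𝕜 := ℂ) b x‖ := by
  have hstar : star (CFC.abs b) * CFC.abs b = star b * b := by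
    rw [(CFC.abs_nonneg b).isSelfAdjoint.star_eq, CFC.abs_mul_abs]
  simp only [ContinuousLinearMap.apply_norm_eq_sqrt_inner_adjoint_right,
    ← ContinuousLinearMap.star_eq_adjoint, ← ContinuousLinearMap.mul_def, ← map_star, ← map_mul,
    hstar]

open scoped MatrixOrder ComplexOrder in
lemma exists_orthonormalBasis_traceNorm_eq_sum_norm (b : Matrix n n ℂ) :
    ∃ v : OrthonormalBasis n ℂ (EuclideanSpace ℂ n),
      traceNorm b = ∑ i, ‖Matrix.toEuclideanCLM (n := n) (𝕜 := ℂ) b (v i)‖ := by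
  have hpos : (CFC.abs b).PosSemidef := Matrix.nonneg_iff_posSemidef.1 (CFC.abs_nonneg b)
  refine ⟨hpos.isHermitian.eigenvectorBasis, ?_⟩
  rw [traceNorm, hpos.isHermitian.trace_eq_sum_eigenvalues, Complex.re_sum]
  refine Finset.sum_congr rfl fun i _ => ?_
  have heigen : Matrix.toEuclideanCLM (n := n) (𝕜 := ℂ) (CFC.abs b)
      (hpos.isHermitian.eigenvectorBasis i) =
        (hpos.isHermitian.eigenvalues i : ℂ) • hpos.isHermitian.eigenvectorBasis i := by
    apply WithLp.ofLp_injective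
    simpa using hpos.isHermitian.mulVec_eigenvectorBasis i
  rw [← norm_toEuclideanCLM_abs_apply, heigen, norm_smul, OrthonormalBasis.norm_eq_one, mul_one,
    Complex.norm_real, Real.norm_of_nonneg (hpos.eigenvalues_nonneg i)]
  exact Complex.ofReal_re _

lemma norm_trace_mul_le_opNorm_mul_traceNorm (c b : Matrix n n ℂ) :
    ‖(c * b).trace‖ ≤ opNorm c * traceNorm b := by
  obtain ⟨v, hv⟩ := exists_orthonormalBasis_traceNorm_eq_sum_norm b
  rw [trace_eq_sum_inner_toEuclideanCLM _ v, hv, Finset.mul_sum]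
  refine norm_sum_le_of_le _ fun i _ => ?_
  calc ‖inner ℂ (v i) (Matrix.toEuclideanCLM (n := n) (𝕜 := ℂ) (c * b) (v i))‖
      ≤ ‖v i‖ * ‖Matrix.toEuclideanCLM (n := n) (𝕜 := ℂ) (c * b) (v i)‖ := norm_inner_le_norm _ _
    _ = ‖Matrix.toEuclideanCLM (n := n) (𝕜 := ℂ) c
          (Matrix.toEuclideanCLM (n := n) (𝕜 := ℂ) b (v i))‖ := by
        rw [v.norm_eq_one, one_mul, map_mul, mul_apply_eq_comp]
    _ ≤ opNorm c * ‖Matrix.toEuclideanCLM (n := n) (𝕜 := ℂ) b (v i)‖ :=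
        ContinuousLinearMap.le_opNorm _ _

open scoped MatrixOrder in
lemma traceNorm_of_isStarProjection {p : Matrix n n ℂ} (hp : IsStarProjection p) :
    traceNorm p = p.trace.re := by
  rw [traceNorm, CFC.abs_of_nonneg p hp.nonneg]

open scoped Matrix.Norms.L2Operator in
lemma opNorm_two_mul_sub_one_of_isStarProjection [Nonempty n] {p : Matrix n n ℂ}
    (hp : IsStarProjection p) : opNorm (2 * p - 1) = 1 :=
  (opNorm_eq_norm _).trans <| CStarRing.norm_of_mem_unitary hp.two_mul_sub_one_mem_unitary

end TraceDuality

section ProjectiveNorm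

variable {n : Type*} [Fintype n] [DecidableEq n]

lemma exists_eq_sum_kronecker {R l m p q : Type*} [CommSemiring R] [Finite l] [Finite m] [Finite p]
    [Finite q] (x : Matrix (l × p) (m × q) R) :
    ∃ (k : ℕ) (a : Fin k → Matrix l m R) (b : Fin k → Matrix p q R), x = ∑ i, a i ⊗ₖ b i := by
  classical
  have := Fintype.ofFinite l
  have := Fintype.ofFinite m
  have := Fintype.ofFinite p
  have := Fintype.ofFinite q
  obtain ⟨S, hS⟩ := TensorProduct.exists_finset ((kroneckerLinearEquiv l m p q R).symm x)
  let e := S.equivFin.symm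
  refine ⟨S.card, fun i => (e i).1.1, fun i => (e i).1.2, ?_⟩
  rw [e.sum_comp (fun s => s.1.1 ⊗ₖ s.1.2), S.sum_coe_sort (fun s => s.1 ⊗ₖ s.2),
    (LinearEquiv.symm_apply_eq _).1 hS, map_sum]
  rfl

lemma projNorm_nonneg (x : Matrix (n × n) (n × n) ℂ) : 0 ≤ projNorm x := by
  refine Real.sInf_nonneg ?_
  rintro r ⟨k, a, b, -, rfl⟩
  exact Finset.sum_nonneg fun i _ => mul_nonneg (opNorm_nonneg _) (traceNorm_nonneg _)

lemma projNorm_kronecker_le (a b : Matrix n n ℂ) :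
    projNorm (a ⊗ₖ b) ≤ opNorm a * traceNorm b := by
  refine csInf_le ⟨0, ?_⟩ ⟨1, fun _ => a, fun _ => b, by simp, by simp⟩
  rintro r ⟨k, a, b, -, rfl⟩
  exact Finset.sum_nonneg fun i _ => mul_nonneg (opNorm_nonneg _) (traceNorm_nonneg _)

variable {ρ : Matrix (n × n) (n × n) ℂ} {C : ℝ}

lemma norm_trace_mul_le_mul_projNorm (hC : 0 < C)
    (hbound : ∀ a b : Matrix n n ℂ, ‖(ρ * a ⊗ₖ b).trace‖ ≤ C * (opNorm a * traceNorm b))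
    (x : Matrix (n × n) (n × n) ℂ) : ‖(ρ * x).trace‖ ≤ C * projNorm x := by
  obtain ⟨k, a, b, hx⟩ := exists_eq_sum_kronecker x
  rw [← div_le_iff₀' hC]
  refine le_csInf ⟨_, k, a, b, hx, rfl⟩ ?_
  rintro r ⟨k, a, b, rfl, rfl⟩
  rw [div_le_iff₀' hC, Finset.mul_sum, Finset.mul_sum, Matrix.trace_sum]
  exact norm_sum_le_of_le _ fun i _ => hbound _ _

lemma alphaNorm_eq_of_norm_trace_kronecker (hC : 0 < C)
    (hbound : ∀ a b : Matrix n n ℂ, ‖(ρ * a ⊗ₖ b).trace‖ ≤ C * (opNorm a * traceNorm b))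
    {a b : Matrix n n ℂ} (hab : 0 < opNorm a * traceNorm b)
    (hattained : ‖(ρ * a ⊗ₖ b).trace‖ = C * (opNorm a * traceNorm b)) : alphaNorm ρ = C := by
  have hle := norm_trace_mul_le_mul_projNorm hC hbound
  have hproj : projNorm (a ⊗ₖ b) = opNorm a * traceNorm b :=
    (projNorm_kronecker_le a b).antisymm <|
      le_of_mul_le_mul_left (hattained ▸ hle (a ⊗ₖ b)) hC
  refine IsGreatest.csSup_eq ⟨⟨a ⊗ₖ b, fun hzero => ?_, ?_⟩, ?_⟩
  · rw [hzero, mul_zero, Matrix.trace_zero, norm_zero] at hattained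
    exact (mul_pos hC hab).ne hattained
  · rw [hattained, hproj, mul_div_cancel_right₀ _ hab.ne']
  · rintro r ⟨x, -, rfl⟩
    exact div_le_of_le_mul₀ (projNorm_nonneg x) hC.le (hle x)

end ProjectiveNorm

section Pinching

variable {n : Type*} [DecidableEq n] {G : Type*} [AddCommGroup G]

/-- The diagonal matrix with entries `ψ (e i)`, for a character `ψ` of an abelian group and a
labelling `e` of the indices by group elements. Conjugating by all of these averages a matrix to its
diagonal part. -/
noncomputable def charDiagonal (e : n → G) (ψ : AddChar G ℂ) : Matrix n n ℂ :=
  Matrix.diagonal fun i => ψ (e i)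

lemma charDiagonal_zero (e : n → G) : charDiagonal e 0 = 1 := by
  simp [charDiagonal]

lemma star_charDiagonal [Finite G] (e : n → G) (ψ : AddChar G ℂ) :
    star (charDiagonal e ψ) = Matrix.diagonal fun i => ψ (-e i) := by
  simp only [charDiagonal, Matrix.star_eq_conjTranspose, Matrix.diagonal_conjTranspose,
    AddChar.map_neg_eq_conj]
  rfl

variable [Fintype n]

lemma charDiagonal_mem_unitaryGroup [Finite G] (e : n → G) (ψ : AddChar G ℂ) :
    charDiagonal e ψ ∈ Matrix.unitaryGroup n ℂ := by
  rw [Matrix.mem_unitaryGroup_iff, star_charDiagonal, charDiagonal, Matrix.diagonal_mul_diagonal]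
  simp only [← AddChar.map_add_eq_mul, add_neg_cancel, AddChar.map_zero_eq_one,
    Matrix.diagonal_one]

open scoped Matrix.Norms.L2Operator in
lemma norm_charDiagonal_conj [Finite G] (e : n → G) (ψ : AddChar G ℂ) (a : Matrix n n ℂ) :
    ‖charDiagonal e ψ * a * star (charDiagonal e ψ)‖ = ‖a‖ := by
  have hu := charDiagonal_mem_unitaryGroup e ψ
  rw [CStarRing.norm_mul_mem_unitary _ (Unitary.star_mem hu), CStarRing.norm_mem_unitary_mul _ hu]

lemma sum_charDiagonal_conj [Fintype G] {e : n → G} (he : Function.Injective e)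
    (a : Matrix n n ℂ) :
    ∑ ψ : AddChar G ℂ, charDiagonal e ψ * a * star (charDiagonal e ψ) =
      (Fintype.card G : ℂ) • Matrix.diagonal a.diag := by
  classical
  ext i j
  have hentry (ψ : AddChar G ℂ) :
      (charDiagonal e ψ * a * star (charDiagonal e ψ)) i j = ψ (e i - e j) * a i j := by
    rw [star_charDiagonal, charDiagonal, Matrix.mul_diagonal, Matrix.diagonal_mul,
      sub_eq_add_neg, AddChar.map_add_eq_mul, mul_right_comm]
  simp only [Matrix.sum_apply, hentry, ← Finset.sum_mul, AddChar.sum_apply_eq_ite, sub_eq_zero,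
    he.eq_iff, Matrix.smul_apply, Matrix.diagonal_apply, Matrix.diag_apply, smul_eq_mul]
  split_ifs with hij
  · rw [hij]
  · simp

end Pinching

section SignedSwap

variable {n : Type*} [DecidableEq n]

/-- The Schur multiplier that keeps the diagonal of a matrix and changes the sign of the other
entries. It represents the signed swap under the trace pairing. -/
def negOffDiag (a : Matrix n n ℂ) : Matrix n n ℂ := (2 : ℂ) • Matrix.diagonal a.diag - a

lemma negOffDiag_apply (a : Matrix n n ℂ) (i j : n) :
    negOffDiag a i j = (if i = j then 1 else -1) * a i j := by
  simp only [negOffDiag, Matrix.sub_apply, Matrix.smul_apply, Matrix.diagonal_apply,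
    Matrix.diag_apply, smul_eq_mul]
  split_ifs with hij
  · rw [hij]
    ring
  · ring

variable [Fintype n]

section Norm

variable {G : Type*} [AddCommGroup G] [Fintype G]

lemma card_smul_negOffDiag {e : n → G} (he : Function.Injective e) (a : Matrix n n ℂ) :
    (Fintype.card G : ℂ) • negOffDiag a =
      (2 : ℂ) • ∑ ψ ∈ Finset.univ.erase (0 : AddChar G ℂ),
        charDiagonal e ψ * a * star (charDiagonal e ψ) - (Fintype.card G - 2 : ℂ) • a := by
  have hsum := sum_charDiagonal_conj he a
  rw [← Finset.add_sum_erase _ _ (Finset.mem_univ 0), charDiagonal_zero, one_mul, star_one,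
    mul_one] at hsum
  rw [negOffDiag, smul_sub, smul_comm, ← hsum]
  module

open scoped Matrix.Norms.L2Operator in
lemma card_mul_opNorm_negOffDiag_le (hG : 2 ≤ Fintype.card G) {e : n → G}
    (he : Function.Injective e) (a : Matrix n n ℂ) :
    Fintype.card G * opNorm (negOffDiag a) ≤ (3 * Fintype.card G - 4) * opNorm a := by
  simp only [opNorm_eq_norm]
  have hcoeff : ‖(Fintype.card G - 2 : ℂ)‖ = Fintype.card G - 2 := by
    rw [← Nat.cast_ofNat, ← Nat.cast_sub hG, Complex.norm_natCast, Nat.cast_sub hG,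
      Nat.cast_ofNat]
  have hcard : ((Finset.univ.erase (0 : AddChar G ℂ)).card : ℝ) = Fintype.card G - 1 := by
    rw [Finset.card_erase_of_mem (Finset.mem_univ _), Finset.card_univ, AddChar.card_eq,
      Nat.cast_sub (by omega), Nat.cast_one]
  have hsum : ‖∑ ψ ∈ Finset.univ.erase (0 : AddChar G ℂ),
      charDiagonal e ψ * a * star (charDiagonal e ψ)‖ ≤ (Fintype.card G - 1) * ‖a‖ := by
    refine (norm_sum_le _ _).trans_eq ?_
    simp only [norm_charDiagonal_conj, Finset.sum_const, nsmul_eq_mul, hcard]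
  calc Fintype.card G * ‖negOffDiag a‖ = ‖(Fintype.card G : ℂ) • negOffDiag a‖ := by
        rw [norm_smul, Complex.norm_natCast]
    _ ≤ 2 * ((Fintype.card G - 1) * ‖a‖) + (Fintype.card G - 2) * ‖a‖ := by
        rw [card_smul_negOffDiag he]
        refine norm_sub_le_of_le ?_ ?_
        · rw [norm_smul, Complex.norm_ofNat]
          gcongr
        · rw [norm_smul, hcoeff]
    _ = (3 * Fintype.card G - 4) * ‖a‖ := by ring

end Norm

lemma opNorm_negOffDiag_le (hn : 2 ≤ Fintype.card n) (a : Matrix n n ℂ) :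
    opNorm (negOffDiag a) ≤ (3 - 4 / Fintype.card n) * opNorm a := by
  have : NeZero (Fintype.card n) := ⟨by omega⟩
  let e : n ≃ ZMod (Fintype.card n) := Fintype.equivOfCardEq (ZMod.card _).symm
  have hscaled := card_mul_opNorm_negOffDiag_le (by rwa [ZMod.card]) e.injective a
  rw [ZMod.card] at hscaled
  have hpos : (0 : ℝ) < Fintype.card n := by positivity
  refine le_of_mul_le_mul_left (hscaled.trans_eq ?_) hpos
  field_simp

variable (n) in
/-- The signed swap `∑ ε_ij E_ij ⊗ E_ji` on `ℂⁿ ⊗ ℂⁿ` for an arbitrary finite index type, with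
`ε_ij = 1` if `i = j` and `ε_ij = -1` otherwise; `wMinus` is the case `n = Fin 3`. -/
def signedSwap : Matrix (n × n) (n × n) ℂ :=
  ∑ i : n, ∑ j : n, (if i = j then (1 : ℂ) else -1) •
    (Matrix.single i j (1 : ℂ) ⊗ₖ Matrix.single j i (1 : ℂ))

lemma wMinus_eq_signedSwap : wMinus = signedSwap (Fin 3) := rfl

lemma signedSwap_apply (p q : n × n) :
    signedSwap n p q = if q = p.swap then (if p.1 = p.2 then 1 else -1) else 0 := by
  obtain ⟨i, j⟩ := p
  obtain ⟨k, l⟩ := q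
  simp only [signedSwap, Matrix.sum_apply, Matrix.smul_apply, Matrix.single_kronecker_single,
    Matrix.single_apply]
  rw [Fintype.sum_eq_single i, Fintype.sum_eq_single j]
  · simp [eq_comm, and_comm]
  · intro s hs
    simp [hs]
  · intro r hr
    simp [hr]

lemma isSymmetry_signedSwap : IsSymmetry (signedSwap n) := by
  have hstar : star (signedSwap n) = signedSwap n := by
    ext p q
    simp only [Matrix.star_apply, signedSwap_apply]
    by_cases hpq : q = p.swap
    · by_cases hdiag : p.1 = p.2
      · simp [hpq, hdiag]
      · simp [hpq, hdiag, Ne.symm hdiag]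
    · have hqp : p ≠ q.swap := fun h => hpq (by rw [h, Prod.swap_swap])
      simp [hpq, hqp]
  refine ⟨hstar, Matrix.mem_unitaryGroup_iff.2 ?_⟩
  rw [hstar]
  ext p q
  simp only [Matrix.mul_apply, signedSwap_apply, ite_mul, zero_mul, Finset.sum_ite_eq',
    Finset.mem_univ, if_true, Prod.swap_swap, Prod.fst_swap, Prod.snd_swap, Matrix.one_apply]
  by_cases hpq : q = p
  · by_cases hdiag : p.1 = p.2
    · simp [hpq, hdiag]
    · simp [hpq, hdiag, Ne.symm hdiag]
  · simp [hpq, Ne.symm hpq]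

lemma trace_signedSwap_mul_kronecker (a b : Matrix n n ℂ) :
    (signedSwap n * a ⊗ₖ b).trace = (negOffDiag a * b).trace := by
  simp only [signedSwap, Finset.sum_mul, smul_mul_assoc, ← Matrix.mul_kronecker_mul,
    Matrix.trace_sum, Matrix.trace_smul, Matrix.trace_kronecker, Matrix.trace_single_mul,
    smul_eq_mul]
  rw [Finset.sum_comm]
  simp only [Matrix.trace, Matrix.diag_apply, Matrix.mul_apply, negOffDiag_apply, mul_assoc,
    one_mul, eq_comm]

lemma not_isBlockPositive_signedSwap (hn : 3 ≤ Fintype.card n) :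
    ¬ IsBlockPositive (signedSwap n) := by
  intro hpos
  have hones : star (tensorVec (n := n) 1 1) ⬝ᵥ (signedSwap n).mulVec (tensorVec 1 1) =
      ∑ i : n, ∑ j : n, if i = j then (1 : ℂ) else -1 := by
    simp [dotProduct, Matrix.mulVec, tensorVec, signedSwap_apply, Fintype.sum_prod_type]
  have hsum : ∑ i : n, ∑ j : n, (if i = j then (1 : ℂ) else -1) =
      ((Fintype.card n * (2 - Fintype.card n) : ℝ) : ℂ) := by
    have hsign (i j : n) : (if i = j then (1 : ℂ) else -1) = 2 * (if i = j then 1 else 0) - 1 := by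
      split_ifs <;> norm_num
    simp only [hsign, Finset.sum_sub_distrib, ← Finset.mul_sum, Finset.sum_ite_eq, Finset.mem_univ,
      if_true, Finset.sum_const, Finset.card_univ, nsmul_eq_mul]
    push_cast
    ring
  have hnonneg : (0 : ℝ) ≤ Fintype.card n * (2 - Fintype.card n) := by
    have h := hpos 1 1
    rwa [hones, hsum, Complex.zero_le_real] at h
  have hn3 : (3 : ℝ) ≤ Fintype.card n := by exact_mod_cast hn
  nlinarith

end SignedSwap

section ConstProj

variable {n : Type*} [Fintype n]

variable (n) in
/-- The rank-one projection of `ℂⁿ` onto the constant vectors. It gives the elementary tensor at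
which the bound on the signed swap is attained. -/
noncomputable def constProj : Matrix n n ℂ := Matrix.of fun _ _ => (Fintype.card n : ℂ)⁻¹

lemma negOffDiag_two_mul_constProj_sub_one [DecidableEq n] :
    negOffDiag (2 * constProj n - 1) =
      (4 / Fintype.card n - 1 : ℂ) • 1 - (2 : ℂ) • constProj n := by
  ext i j
  simp only [negOffDiag_apply, constProj, two_mul, Matrix.sub_apply, Matrix.add_apply,
    Matrix.smul_apply, Matrix.of_apply, Matrix.one_apply, smul_eq_mul]
  split_ifs <;> ring

variable [Nonempty n]

lemma isStarProjection_constProj : IsStarProjection (constProj n) where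
  isIdempotentElem := by
    ext i j
    simp [constProj, Matrix.mul_apply]
  isSelfAdjoint := by
    ext i j
    simp [constProj]

lemma trace_constProj : (constProj n).trace = 1 := by
  simp [Matrix.trace, constProj]

variable [DecidableEq n]

lemma traceNorm_constProj : traceNorm (constProj n) = 1 := by
  rw [traceNorm_of_isStarProjection isStarProjection_constProj, trace_constProj, Complex.one_re]

lemma trace_signedSwap_mul_reflection_kronecker :
    (signedSwap n * (2 * constProj n - 1) ⊗ₖ constProj n).trace =
      (4 / Fintype.card n - 3 : ℂ) := by
  rw [trace_signedSwap_mul_kronecker, negOffDiag_two_mul_constProj_sub_one, sub_mul, smul_mul_assoc,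
    smul_mul_assoc, one_mul, isStarProjection_constProj.isIdempotentElem.eq, Matrix.trace_sub,
    Matrix.trace_smul, Matrix.trace_smul, trace_constProj]
  simp only [smul_eq_mul]
  ring

end ConstProj

lemma alphaNorm_signedSwap {n : Type*} [Fintype n] [DecidableEq n]
    (hn : 2 ≤ Fintype.card n) :
    alphaNorm (signedSwap n) = 3 - 4 / Fintype.card n := by
  have : Nonempty n := Fintype.card_pos_iff.1 (by omega)
  have hpos : (0 : ℝ) < 3 - 4 / Fintype.card n := by
    have hn2 : (2 : ℝ) ≤ Fintype.card n := by exact_mod_cast hn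
    have : (4 : ℝ) / Fintype.card n ≤ 4 / 2 := by gcongr
    linarith
  have hnorm : opNorm (2 * constProj n - 1) * traceNorm (constProj n) = 1 := by
    rw [opNorm_two_mul_sub_one_of_isStarProjection isStarProjection_constProj, traceNorm_constProj,
      one_mul]
  refine alphaNorm_eq_of_norm_trace_kronecker hpos (fun a b => ?_) (hnorm ▸ one_pos) ?_
  · rw [trace_signedSwap_mul_kronecker, ← mul_assoc]
    exact (norm_trace_mul_le_opNorm_mul_traceNorm _ _).trans
      (mul_le_mul_of_nonneg_right (opNorm_negOffDiag_le hn a) (traceNorm_nonneg b))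
  · have hreal : (4 / Fintype.card n - 3 : ℂ) = -((3 - 4 / Fintype.card n : ℝ) : ℂ) := by
      push_cast
      ring
    rw [hnorm, mul_one, trace_signedSwap_mul_reflection_kronecker, hreal, norm_neg,
      Complex.norm_real, Real.norm_of_nonneg hpos.le]

theorem mainTheorem6_general {n : Type*} [Fintype n] [DecidableEq n] (hn : 3 ≤ Fintype.card n) :
    IsSymmetry (signedSwap n) ∧ ¬ IsBlockPositive (signedSwap n) ∧
      alphaNorm (signedSwap n) = 3 - 4 / Fintype.card n :=
  ⟨isSymmetry_signedSwap, not_isBlockPositive_signedSwap hn, alphaNorm_signedSwap (by omega)⟩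

theorem mainTheorem6 :
    IsSymmetry wMinus ∧ ¬ IsBlockPositive wMinus ∧ alphaNorm wMinus = 5 / 3 := by
  rw [wMinus_eq_signedSwap, show (5 / 3 : ℝ) = 3 - 4 / Fintype.card (Fin 3) by norm_num]
  exact mainTheorem6_general (by simp)
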